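/- **Theorem ($n$th Root Test).** Let $E=E_\rho\oplus iE_\rho$ be a universally complete Archimedean complex vector lattice, i.e. the vector space complexification of a real vector lattice $E_\rho$ that is Dedekind complete and in which every non-empty set of pairwise disjoint positive elements has a supremum, with modulus $|f+ig|=\sup\{(\cos\theta)f+(\sin\theta)g:\theta\in[0,2\pi]\}\in E_\rho$ for $f,g\in E_\rho$. Let $E_\rho$ carry an $f$-algebra multiplication with identity $e$; for $0\le a\in E_\rho$ and $n\ge 1$ let $a^{1/n}$ be the unique $r\ge 0$ in $E_\rho$ with $r^n=a$. For $x,y\in E_\rho$ write $x\ll y$ if $(y-x)^+$ is a weak order unit, and for an order bounded sequence put $\limsup_{n\to\infty} x_n=\inf_{n}\sup_{m\ge n}x_m$. A sequence $(x_n)$ in $E$ converges in order to $x$ if there is a decreasing sequence $(p_n)$ in $E_\rho$ with $\inf_n p_n=0$ and $|x_n-x|\le p_n$ for all $n$; a series $\sum_{n=0}^\infty a_n$ in $E$ converges in order if its sequence of partial sums does, and converges absolutely in order if $\sum_{n=0}^\infty|a_n|$ converges in order. Let $\sum_{n=0}^\infty a_n$ be a series in $E$. (i) If $(|a_n|^{1/n})_{n\ge1}$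 is order bounded and $\limsup_{n\to\infty}|a_n|^{1/n}\ll e$, then $\sum_{n=0}^\infty a_n$ converges absolutely in order. (ii) If $\sum_{n=0}^\infty a_n$ converges in order, then $(|a_n|^{1/n})_{n\ge1}$ is order bounded and $\limsup_{n\to\infty}|a_n|^{1/n}\le e$. (iii) If $(|a_n|^{1/n})_{n\ge1}$ is order bounded with $\limsup_{n\to\infty}|a_n|^{1/n}\le e$ and $\limsup_{n\to\infty}|a_n|^{1/n}\not\ll e$, then the test is inconclusive. That is, if $E\ne\{0\}$, then $E$ contains both a series with these properties that converges in order and a series with these properties that does not. Specifically: - the series $\sum_{n=1}^\infty\frac1{n^2}e$ converges in order, its sequence of roots is order bounded, and $\limsup_{n\to\infty}(\frac1{n^2}e)^{1/n}=e$, where $e\not\ll e$ if $E\neq\{0\}$; - in $\mathbb C^{\mathbb C}$ (whose real part $\mathbb R^{\mathbb C}$, with the pointwise order and multiplication, satisfies the assumptions above), let $f_n$ be the characteristic function of the closed disk of radius $1/n$ about $0$. Then $(|f_n|^{1/n})_{n\ge 1}$ is order bounded and $L:=\limsup_{n\to\infty}|f_n|^{1/n}=\chi_{\{0\}}$, so that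 $L\le\mathbf 1$ and $L\not\ll\mathbf 1$, and $\sum_{n=1}^\infty f_n$ does not converge in order. -/

import Mathlib

namespace CVL

/-!
Throughout, a universally complete Archimedean complex vector lattice `E = R ⊕ iR` is given by its
real part `R`.  That `R` is a Dedekind complete real vector lattice is expressed by
`[ConditionallyCompleteLattice R]`, `[IsOrderedAddMonoid R]` and `[PosSMulMono ℝ R]` (Dedekind
completeness implies that `R` is Archimedean, and that the supremum in the modulus exists).
Universal completeness adds `IsLaterallyComplete R`, and the multiplication with identity
`e = (1 : R)` satisfies `IsFAlgebra R`.
-/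

/-- Every (non-empty) set of pairwise disjoint positive elements has a supremum. -/
class IsLaterallyComplete (R : Type*) [AddCommGroup R] [Lattice R] : Prop where
  exists_isLUB : ∀ S : Set R, S.Nonempty → (∀ x ∈ S, 0 ≤ x) →
    S.Pairwise (fun x y => x ⊓ y = 0) → ∃ s, IsLUB S s

/-- The axioms that make a vector lattice with an associative multiplication an `f`-algebra.
Commutativity is not assumed. -/
class IsFAlgebra (R : Type*) [Ring R] [Lattice R] : Prop where
  mul_nonneg : ∀ a b : R, 0 ≤ a → 0 ≤ b → 0 ≤ a * b
  mul_left_inf : ∀ a b c : R, a ⊓ b = 0 → 0 ≤ c → (c * a) ⊓ b = 0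
  mul_right_inf : ∀ a b c : R, a ⊓ b = 0 → 0 ≤ c → (a * c) ⊓ b = 0

/-- The vector space complexification `R ⊕ iR`. -/
@[ext]
structure Complexification (R : Type*) where
  re : R
  im : R

namespace Complexification

section Algebra

variable {R : Type*} [AddCommGroup R]

instance : Zero (Complexification R) := ⟨⟨0, 0⟩⟩
instance : Add (Complexification R) := ⟨fun z w => ⟨z.re + w.re, z.im + w.im⟩⟩
instance : Neg (Complexification R) := ⟨fun z => ⟨-z.re, -z.im⟩⟩
instance : Sub (Complexification R) := ⟨fun z w => ⟨z.re - w.re, z.im - w.im⟩⟩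

@[simp] theorem zero_re : (0 : Complexification R).re = 0 := rfl
@[simp] theorem zero_im : (0 : Complexification R).im = 0 := rfl
@[simp] theorem add_re (z w : Complexification R) : (z + w).re = z.re + w.re := rfl
@[simp] theorem add_im (z w : Complexification R) : (z + w).im = z.im + w.im := rfl
@[simp] theorem neg_re (z : Complexification R) : (-z).re = -z.re := rfl
@[simp] theorem neg_im (z : Complexification R) : (-z).im = -z.im := rfl
@[simp] theorem sub_re (z w : Complexification R) : (z - w).re = z.re - w.re := rfl
@[simp] theorem sub_im (z w : Complexification R) : (z - w).im = z.im - w.im := rfl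

instance : AddCommGroup (Complexification R) where
  add_assoc _ _ _ := by ext <;> simp [add_assoc]
  zero_add _ := by ext <;> simp
  add_zero _ := by ext <;> simp
  add_comm _ _ := by ext <;> simp [add_comm]
  neg_add_cancel _ := by ext <;> simp
  sub_eq_add_neg _ _ := by ext <;> simp [sub_eq_add_neg]
  nsmul := nsmulRec
  zsmul := zsmulRec

variable [Module ℝ R]

/-- `(α + iβ)(f + ig) = (αf - βg) + i(αg + βf)`. -/
instance : SMul ℂ (Complexification R) :=
  ⟨fun c z => ⟨c.re • z.re - c.im • z.im, c.re • z.im + c.im • z.re⟩⟩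

@[simp] theorem smul_re (c : ℂ) (z : Complexification R) :
    (c • z).re = c.re • z.re - c.im • z.im := rfl
@[simp] theorem smul_im (c : ℂ) (z : Complexification R) :
    (c • z).im = c.re • z.im + c.im • z.re := rfl

instance : Module ℂ (Complexification R) where
  one_smul _ := by ext <;> simp
  mul_smul _ _ _ := by ext <;> simp <;> module
  smul_zero _ := by ext <;> simp
  smul_add _ _ _ := by ext <;> simp <;> module
  add_smul _ _ _ := by ext <;> simp <;> module
  zero_smul _ := by ext <;> simp

end Algebra

/-- The inclusion of the real part `R` into `R ⊕ iR`. -/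
def ofReal {R : Type*} [Zero R] (f : R) : Complexification R := ⟨f, 0⟩

/-- The modulus `|f + ig| = sup {(cos θ) f + (sin θ) g : θ ∈ [0, 2π]}`, as an element of the real
part. -/
noncomputable def modulus {R : Type*} [AddCommGroup R] [Module ℝ R]
    [ConditionallyCompleteLattice R] (z : Complexification R) : R :=
  sSup ((fun θ : ℝ => Real.cos θ • z.re + Real.sin θ • z.im) '' Set.Icc 0 (2 * Real.pi))

end Complexification

open Complexification

/-- `u` is a weak order unit: it is positive and only `0` is disjoint from it. -/
def IsWeakOrderUnit {R : Type*} [AddCommGroup R] [Lattice R] (u : R) : Prop :=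
  0 ≤ u ∧ ∀ x : R, |x| ⊓ u = 0 → x = 0

/-- The relation `x ≪ y`: the positive part of `y - x` is a weak order unit. -/
def MuchLess {R : Type*} [AddCommGroup R] [Lattice R] (x y : R) : Prop :=
  IsWeakOrderUnit ((y - x) ⊔ 0)

/-- The sequence is contained in an order interval. -/
def OrderBounded {R : Type*} [Preorder R] (x : ℕ → R) : Prop :=
  BddBelow (Set.range x) ∧ BddAbove (Set.range x)

/-- `limsup x = inf_n sup_{m ≥ n} x_m` (meaningful for order bounded sequences). -/
noncomputable def orderLimsup {R : Type*} [ConditionallyCompleteLattice R] (x : ℕ → R) : R :=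
  ⨅ n : ℕ, ⨆ k : ℕ, x (n + k)

/-- `r` is an `n`th root of `a`. -/
def IsNthRoot {R : Type*} [Ring R] [Lattice R] (n : ℕ) (a r : R) : Prop :=
  0 ≤ r ∧ r ^ n = a

open Classical in
/-- The `n`th root `a^{1/n}` of a positive element `a`, for `n ≥ 1` (it exists and is unique in the
algebras considered here). -/
noncomputable def nthRoot {R : Type*} [Ring R] [Lattice R] (n : ℕ) (a : R) : R :=
  if h : ∃ r : R, IsNthRoot n a r then h.choose else 0

section Convergence

variable {R : Type*} [AddCommGroup R] [Module ℝ R] [ConditionallyCompleteLattice R]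

/-- `x_n → l` in order: there is a decreasing sequence `p` with infimum `0` in the real part such
that `|x_n - l| ≤ p_n` for all `n`. -/
def OrderTendsto (x : ℕ → Complexification R) (l : Complexification R) : Prop :=
  ∃ p : ℕ → R, Antitone p ∧ IsGLB (Set.range p) 0 ∧ ∀ n, modulus (x n - l) ≤ p n

/-- The series `∑_{n ≥ 0} a_n` converges in order. -/
def SeriesConverges (a : ℕ → Complexification R) : Prop :=
  ∃ s, OrderTendsto (fun m => ∑ n ∈ Finset.range (m + 1), a n) s

/-- The series `∑_{n ≥ 0} a_n` converges absolutely in order. -/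
def SeriesConvergesAbsolutely (a : ℕ → Complexification R) : Prop :=
  SeriesConverges (fun n => ofReal (modulus (a n)))

end Convergence

section Roots

variable {R : Type*} [Ring R] [Algebra ℝ R] [ConditionallyCompleteLattice R]

/-- The sequence `(|a_n|^{1/n})_{n ≥ 1}`, listed from index `0`: its `k`th entry is the one with
`n = k + 1`. -/
noncomputable def rootSeq (a : ℕ → Complexification R) (k : ℕ) : R :=
  nthRoot (k + 1) (modulus (a (k + 1)))

variable (R) in
/-- The terms of the series `∑_{n ≥ 1} (1/n²) e`, with `0` as the term of index `0`. -/
noncomputable def inverseSquares (n : ℕ) : Complexification R :=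
  if n = 0 then 0 else ofReal (((1 : ℝ) / (n : ℝ) ^ 2) • (1 : R))

end Roots

/-- The terms of the series `∑_{n ≥ 1} χ_n` in `ℂ^ℂ`, where `χ_n` is the characteristic function of
the closed disk of radius `1/n` about `0`, with `0` as the term of index `0`. -/
noncomputable def diskSeries (n : ℕ) : Complexification (ℂ → ℝ) :=
  if n = 0 then 0
  else ofReal ((Metric.closedBall (0 : ℂ) (1 / (n : ℝ))).indicator (fun _ => (1 : ℝ)))

end CVL

open CVL

/-! The scalar root test is run on bands, and the pieces are glued by lateral completeness.
`supportUnit x`, the component of `e` in the band of `x⁺`, is an idempotent with `supportUnit x * x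
= x⁺`, so multiplying by it restricts to the part where `x` is positive. If such idempotents
increase and exhaust `e`, a set bounded on each of them is bounded (`bddAbove_of_forall_mul_le`).

For (i), `L ≪ e` says that the bands where the tail suprema of the roots stay below `1 - 1/(n+1)`
exhaust `e`. On each one the series is dominated by a geometric series up to finitely many terms.
Hence the partial sums of `|a_n|` are bounded, and they converge to their supremum. For (ii), order
convergence bounds the terms by some `c`, and Bernoulli's inequality gives `|a_n|^{1/n} ≤ e + c/n`.
For (iii), a convergent series has terms tending to `0`, which rules out the constant series `e` and
the disk series.

The algebra is shown to be commutative and reduced, with unique roots; existence uses the same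
gluing. -/

namespace CVL

/-! ### Disjointness and the Archimedean property -/

section LatticeGroup

theorem inf_eq_zero_of_le {R : Type*} [Lattice R] [Zero R] {a b c d : R} (h : c ⊓ d = 0)
    (ha : 0 ≤ a) (hb : 0 ≤ b) (hac : a ≤ c) (hbd : b ≤ d) : a ⊓ b = 0 :=
  le_antisymm ((inf_le_inf hac hbd).trans h.le) (le_inf ha hb)

variable {R : Type*} [AddCommGroup R]

section Lattice

variable [Lattice R] [IsOrderedAddMonoid R]

theorem posPart_sub_negPart_eq (x : R) : x ⊔ 0 - (-x) ⊔ 0 = x := by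
  have := posPart_sub_negPart x
  rwa [posPart_def, negPart_def] at this

theorem posPart_inf_negPart (x : R) : (x ⊔ 0) ⊓ ((-x) ⊔ 0) = 0 := by
  have := posPart_inf_negPart_eq_zero x
  rwa [posPart_def, negPart_def] at this

end Lattice

variable [ConditionallyCompleteLattice R] [IsOrderedAddMonoid R]

/-- With `s` the supremum and `w = s ⊓ z`, disjointness gives `y n + w = y n ⊔ w ≤ s`, so `s ≤ s -
w`. This way of absorbing an element into a supremum recurs below. -/
theorem ciSup_inf_eq_zero {y : ℕ → R} {z : R} (hb : BddAbove (Set.range y)) (hy : ∀ n, 0 ≤ y n)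
    (hz : 0 ≤ z) (h : ∀ n, y n ⊓ z = 0) : (⨆ n, y n) ⊓ z = 0 := by
  have hs : 0 ≤ ⨆ n, y n := (hy 0).trans (le_ciSup hb 0)
  refine le_antisymm ?_ (le_inf hs hz)
  have : (⨆ n, y n) ≤ (⨆ n, y n) - (⨆ n, y n) ⊓ z := by
    refine ciSup_le fun n => le_sub_iff_add_le.2 ?_
    have h0 : y n ⊓ ((⨆ n, y n) ⊓ z) = 0 :=
      le_antisymm ((inf_le_inf_left _ inf_le_right).trans (h n).le)
        (le_inf (hy n) (le_inf hs hz))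
    rw [← inf_add_sup, h0, zero_add]
    exact sup_le (le_ciSup hb n) inf_le_left
  simpa using this

end LatticeGroup

section Archimedean

variable {R : Type*} [AddCommGroup R] [Module ℝ R] [ConditionallyCompleteLattice R]
  [IsOrderedAddMonoid R]

/-- A Dedekind complete vector lattice is Archimedean. -/
theorem nonpos_of_forall_natCast_smul_le {x y : R} (h : ∀ n : ℕ, (n : ℝ) • x ≤ y) : x ≤ 0 := by
  have hb : BddAbove (Set.range fun n : ℕ => (n : ℝ) • x) := ⟨y, by rintro _ ⟨n, rfl⟩; exact h n⟩
  have h1 : (⨆ n : ℕ, (n : ℝ) • x) ≤ (⨆ n : ℕ, (n : ℝ) • x) - x := by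
    refine ciSup_le fun n => le_sub_iff_add_le.2 ?_
    have := le_ciSup hb (n + 1)
    simpa [add_smul] using this
  simpa using h1

variable [PosSMulMono ℝ R]

theorem smul_le_smul_of_scalar_le {r s : ℝ} (h : r ≤ s) {x : R} (hx : 0 ≤ x) : r • x ≤ s • x := by
  rw [← sub_nonneg, ← sub_smul]
  exact smul_nonneg (sub_nonneg.2 h) hx

theorem nonpos_of_forall_le_smul {x y : R} (h : ∀ n : ℕ, x ≤ ((n : ℝ) + 1)⁻¹ • y) : x ≤ 0 := by
  refine nonpos_of_forall_natCast_smul_le (y := y - x) fun n => le_sub_iff_add_le.2 ?_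
  have h1 := smul_le_smul_of_nonneg_left (h n) (by positivity : (0 : ℝ) ≤ (n : ℝ) + 1)
  rw [smul_inv_smul₀ (by positivity : (n : ℝ) + 1 ≠ 0)] at h1
  simpa [add_smul] using h1

end Archimedean

/-! ### Multiplication in an `f`-algebra -/

section Ring

variable {R : Type*} [Ring R] [Lattice R] [IsFAlgebra R]

/-- Applying the `f`-algebra axioms twice, `a ⊥ b` gives `ab ⊥ b` and then `ab ⊥ ab`. -/
theorem mul_eq_zero_of_inf_eq_zero {a b : R} (h : a ⊓ b = 0) : a * b = 0 := by
  have ha : 0 ≤ a := h ▸ inf_le_left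
  have hb : 0 ≤ b := h ▸ inf_le_right
  have h1 := IsFAlgebra.mul_right_inf a b b h hb
  rw [inf_comm] at h1
  have h2 := IsFAlgebra.mul_left_inf b (a * b) a h1 ha
  simpa using h2

variable [IsOrderedAddMonoid R]

theorem mul_self_nonneg_of_isFAlgebra (x : R) : 0 ≤ x * x := by
  have h1 : (x ⊔ 0) * ((-x) ⊔ 0) = 0 := mul_eq_zero_of_inf_eq_zero (posPart_inf_negPart x)
  have h2 : ((-x) ⊔ 0) * (x ⊔ 0) = 0 :=
    mul_eq_zero_of_inf_eq_zero (inf_comm (x ⊔ 0) _ ▸ posPart_inf_negPart x)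
  have h3 : x * x = (x ⊔ 0) * (x ⊔ 0) + ((-x) ⊔ 0) * ((-x) ⊔ 0) := by
    conv_lhs => rw [← posPart_sub_negPart_eq x]
    rw [sub_mul, mul_sub, mul_sub, h1, h2]; abel
  rw [h3]
  exact add_nonneg (IsFAlgebra.mul_nonneg _ _ le_sup_right le_sup_right)
    (IsFAlgebra.mul_nonneg _ _ le_sup_right le_sup_right)

instance isOrderedRing_of_isFAlgebra : IsOrderedRing R :=
  haveI : ZeroLEOneClass R := ⟨by simpa using mul_self_nonneg_of_isFAlgebra (1 : R)⟩
  IsOrderedRing.of_mul_nonneg IsFAlgebra.mul_nonneg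

/-- Idempotents in `[0, 1]` are central. -/
theorem mul_comm_of_idempotent {p : R} (h0 : 0 ≤ p) (h1 : p ≤ 1) (hp : p * p = p) {a : R}
    (ha : 0 ≤ a) : p * a = a * p := by
  have hq : 0 ≤ 1 - p := sub_nonneg.2 h1
  have hd : p ⊓ (1 - p) = 0 := by
    have hw : 0 ≤ p ⊓ (1 - p) := le_inf h0 hq
    have e1 : p * (p ⊓ (1 - p)) = 0 := by
      refine le_antisymm ((mul_le_mul_of_nonneg_left inf_le_right h0).trans ?_)
        (mul_nonneg h0 hw)
      simp [mul_sub, hp]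
    have e2 : (1 - p) * (p ⊓ (1 - p)) = 0 := by
      refine le_antisymm ((mul_le_mul_of_nonneg_left inf_le_left hq).trans ?_)
        (mul_nonneg hq hw)
      simp [sub_mul, hp]
    have := congrArg₂ (· + ·) e1 e2
    simpa [sub_mul] using this
  -- Both off-diagonal corners of `a` vanish, so `pa = pap = ap`.
  have e1 : p * a * (1 - p) = 0 := mul_eq_zero_of_inf_eq_zero (IsFAlgebra.mul_right_inf _ _ _ hd ha)
  have e2 : (1 - p) * a * p = 0 :=
    mul_eq_zero_of_inf_eq_zero (IsFAlgebra.mul_right_inf _ _ _ (inf_comm p _ ▸ hd) ha)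
  have e1' : p * a = p * a * p := by simpa [mul_sub, sub_eq_zero] using e1
  have e2' : a * p = p * a * p := by simpa [sub_mul, sub_eq_zero] using e2
  rw [e1', ← e2']

end Ring

/-! ### Support idempotents and commutativity -/

section Support

variable {R : Type*} [Ring R] [ConditionallyCompleteLattice R]

/-- The component of `1` in the band generated by the positive part of `x`. -/
noncomputable def supportUnit (x : R) : R := ⨆ n : ℕ, ((n : R) * (x ⊔ 0)) ⊓ 1

theorem bddAbove_supportUnit (x : R) :
    BddAbove (Set.range fun n : ℕ => ((n : R) * (x ⊔ 0)) ⊓ 1) :=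
  ⟨1, by rintro _ ⟨n, rfl⟩; exact inf_le_right⟩

theorem supportUnit_le_one (x : R) : supportUnit x ≤ 1 := ciSup_le fun _ => inf_le_right

variable [IsOrderedAddMonoid R]

theorem posPart_inf_one_sub_supportUnit (x : R) : (x ⊔ 0) ⊓ (1 - supportUnit x) = 0 := by
  have hq : 0 ≤ 1 - supportUnit x := sub_nonneg.2 (supportUnit_le_one x)
  refine le_antisymm ?_ (le_inf le_sup_right hq)
  -- Adding the meet to the `n`th term of the supremum stays below the `(n+1)`st term.
  have : supportUnit x ≤ supportUnit x - (x ⊔ 0) ⊓ (1 - supportUnit x) := by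
    refine ciSup_le fun n => le_sub_iff_add_le.2 ?_
    refine le_trans (le_inf ?_ ?_) (le_ciSup (bddAbove_supportUnit x) (n + 1))
    · push_cast
      rw [add_mul, one_mul]
      exact add_le_add inf_le_left inf_le_left
    · have := add_le_add (le_ciSup (bddAbove_supportUnit x) n)
        (inf_le_right : (x ⊔ 0) ⊓ (1 - supportUnit x) ≤ _)
      refine this.trans_eq ?_
      change supportUnit x + _ = _
      abel
  simpa using this

variable [IsFAlgebra R]

theorem supportUnit_term_nonneg (x : R) (n : ℕ) : 0 ≤ ((n : R) * (x ⊔ 0)) ⊓ 1 :=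
  le_inf (mul_nonneg n.cast_nonneg le_sup_right) zero_le_one

theorem supportUnit_nonneg (x : R) : 0 ≤ supportUnit x :=
  (supportUnit_term_nonneg x 0).trans (le_ciSup (bddAbove_supportUnit x) 0)

theorem supportUnit_mono {x y : R} (h : x ≤ y) : supportUnit x ≤ supportUnit y :=
  ciSup_mono (bddAbove_supportUnit y) fun n =>
    inf_le_inf_right _ (mul_le_mul_of_nonneg_left (sup_le_sup_right h _) n.cast_nonneg)

theorem supportUnit_inf_eq_zero {x z : R} (hz : 0 ≤ z) (h : (x ⊔ 0) ⊓ z = 0) :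
    supportUnit x ⊓ z = 0 :=
  ciSup_inf_eq_zero (bddAbove_supportUnit x) (supportUnit_term_nonneg x) hz fun n =>
    inf_eq_zero_of_le (IsFAlgebra.mul_left_inf _ _ _ h n.cast_nonneg)
      (supportUnit_term_nonneg x n) hz inf_le_left le_rfl

theorem supportUnit_mul_self (x : R) : supportUnit x * supportUnit x = supportUnit x := by
  have h := mul_eq_zero_of_inf_eq_zero (supportUnit_inf_eq_zero
    (sub_nonneg.2 (supportUnit_le_one x)) (posPart_inf_one_sub_supportUnit x))
  rw [mul_sub, mul_one, sub_eq_zero] at h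
  exact h.symm

/-- The support is disjoint from `x⁻`, and its complement is disjoint from `x⁺`. -/
theorem supportUnit_mul (x : R) : supportUnit x * x = x ⊔ 0 := by
  have h1 : supportUnit x * ((-x) ⊔ 0) = 0 := mul_eq_zero_of_inf_eq_zero
    (supportUnit_inf_eq_zero le_sup_right (posPart_inf_negPart x))
  have h2 : (1 - supportUnit x) * (x ⊔ 0) = 0 := mul_eq_zero_of_inf_eq_zero
    (inf_comm (x ⊔ 0) _ ▸ posPart_inf_one_sub_supportUnit x)
  rw [sub_mul, one_mul, sub_eq_zero] at h2
  calc supportUnit x * x = supportUnit x * (x ⊔ 0 - (-x) ⊔ 0) := by rw [posPart_sub_negPart_eq]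
    _ = x ⊔ 0 := by rw [mul_sub, h1, ← h2, sub_zero]

theorem supportUnit_mul_nonneg (x : R) : 0 ≤ supportUnit x * x :=
  (supportUnit_mul x).symm ▸ le_sup_right

theorem one_sub_supportUnit_mul_nonpos (x : R) : (1 - supportUnit x) * x ≤ 0 := by
  rw [sub_mul, supportUnit_mul, one_mul]
  exact sub_nonpos.2 le_sup_left

/-- Binary expansion: with `p` the support of `2a - 1`, the element `2a - p` lies in `[0, 1]` again.
Since `p` is an idempotent commuting with `b`, the commutator with `b` doubles. -/
theorem commutator_le_of_mem_unitInterval {b : R} (hb : 0 ≤ b) (k : ℕ) :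
    ∀ a : R, 0 ≤ a → a ≤ 1 →
      (2 ^ k : R) * (a * b - b * a) ≤ b ∧ (2 ^ k : R) * (b * a - a * b) ≤ b := by
  induction k with
  | zero =>
    intro a h0 h1
    simp only [pow_zero, one_mul]
    have e1 : a * b ≤ b := by simpa using mul_le_mul_of_nonneg_right h1 hb
    have e2 : b * a ≤ b := by simpa using mul_le_mul_of_nonneg_left h1 hb
    exact ⟨(sub_le_self _ (mul_nonneg hb h0)).trans e1, (sub_le_self _ (mul_nonneg h0 hb)).trans e2⟩
  | succ k ih =>
    intro a h0 h1
    set p := supportUnit (2 * a - 1) with hp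
    have p0 : 0 ≤ p := supportUnit_nonneg _
    have p1 : p ≤ 1 := supportUnit_le_one _
    have hpb : p * b = b * p := mul_comm_of_idempotent p0 p1 (supportUnit_mul_self _) hb
    have ha0 : 0 ≤ 2 * a - p := by
      have e1 := supportUnit_mul_nonneg (2 * a - 1)
      have e2 : 0 ≤ (1 - p) * (2 * a) :=
        mul_nonneg (sub_nonneg.2 p1) (mul_nonneg zero_le_two h0)
      have := add_nonneg e1 e2
      rw [← hp] at this
      refine this.trans_eq ?_
      noncomm_ring
    have ha1 : 2 * a - p ≤ 1 := by
      have e1 := one_sub_supportUnit_mul_nonpos (2 * a - 1)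
      have e2 : 0 ≤ p * (2 * (1 - a)) :=
        mul_nonneg p0 (mul_nonneg zero_le_two (sub_nonneg.2 h1))
      have := add_nonneg (neg_nonneg.2 e1) e2
      rw [← hp] at this
      rw [← sub_nonneg]
      refine this.trans_eq ?_
      noncomm_ring
    have key := ih _ ha0 ha1
    have e : (2 * a - p) * b - b * (2 * a - p) = 2 * (a * b - b * a) := by
      rw [sub_mul, mul_sub, hpb]; noncomm_ring
    have e' : b * (2 * a - p) - (2 * a - p) * b = 2 * (b * a - a * b) := by
      rw [sub_mul, mul_sub, hpb]; noncomm_ring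
    rw [e, e', ← mul_assoc, ← mul_assoc, ← pow_succ] at key
    exact key

/-- The support of `k - a` cuts `a` off at height `k`: on it `a ≤ k`, and on its complement `k ≤ a`.
-/
theorem supportUnit_natCast_sub_mul_le (a : R) (k : ℕ) :
    supportUnit ((k : R) - a) * a ≤ supportUnit ((k : R) - a) * k := by
  have := supportUnit_mul_nonneg ((k : R) - a)
  rwa [mul_sub, sub_nonneg] at this

theorem natCast_mul_one_sub_supportUnit_le {a : R} (ha : 0 ≤ a) (k : ℕ) :
    (1 - supportUnit ((k : R) - a)) * k ≤ a := by
  have h := one_sub_supportUnit_mul_nonpos ((k : R) - a)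
  rw [mul_sub, sub_nonpos] at h
  refine h.trans ?_
  have := mul_le_mul_of_nonneg_right
    (sub_le_self 1 (supportUnit_nonneg ((k : R) - a))) ha
  simpa using this

variable [Algebra ℝ R] [PosSMulMono ℝ R]

theorem mul_comm_of_mem_unitInterval {a b : R} (h0 : 0 ≤ a) (h1 : a ≤ 1) (hb : 0 ≤ b) :
    a * b = b * a := by
  have key : ∀ x : R, (∀ k : ℕ, (2 ^ k : R) * x ≤ b) → x ≤ 0 := by
    intro x hx
    refine nonpos_of_forall_le_smul (y := b) fun n => ?_
    have h2 : x ≤ ((2 : ℝ) ^ n)⁻¹ • b := by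
      have := smul_le_smul_of_nonneg_left (hx n) (by positivity : (0 : ℝ) ≤ ((2 : ℝ) ^ n)⁻¹)
      rw [show (2 ^ n : R) = algebraMap ℝ R (2 ^ n) by rw [map_pow, map_ofNat], ← Algebra.smul_def,
        inv_smul_smul₀ (by positivity)] at this
      exact this
    refine h2.trans ?_
    refine smul_le_smul_of_scalar_le ?_ hb
    refine inv_anti₀ (by positivity) ?_
    exact_mod_cast Nat.lt_two_pow_self (n := n)
  refine le_antisymm (sub_nonpos.1 (key _ fun k => ?_)) (sub_nonpos.1 (key _ fun k => ?_))
  · exact (commutator_le_of_mem_unitInterval hb k a h0 h1).1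
  · exact (commutator_le_of_mem_unitInterval hb k a h0 h1).2

/-- Where `a ≤ k`, a multiple of `a` lies in `[0, 1]` and the commutator vanishes. Elsewhere `k ≤
a`, so `k(ab - ba) ≤ a(ab)`, a bound independent of `k`. -/
theorem mul_le_mul_swap_of_nonneg {a b : R} (ha : 0 ≤ a) (hb : 0 ≤ b) : a * b ≤ b * a := by
  refine sub_nonpos.1 (nonpos_of_forall_natCast_smul_le (y := a * (a * b)) fun k => ?_)
  set q := supportUnit ((k : R) - a) with hq
  have q0 : 0 ≤ q := supportUnit_nonneg _
  have q1 : q ≤ 1 := supportUnit_le_one _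
  have hqb : q * b = b * q := mul_comm_of_idempotent q0 q1 (supportUnit_mul_self _) hb
  have hqa : q * a ≤ k := (supportUnit_natCast_sub_mul_le a k).trans (by
    simpa using mul_le_mul_of_nonneg_right q1 (k.cast_nonneg : (0 : R) ≤ k))
  have hc : q * (a * b - b * a) = 0 := by
    rcases Nat.eq_zero_or_pos k with rfl | hk
    · have : q * a = 0 := le_antisymm (by simpa using hqa) (mul_nonneg q0 ha)
      rw [mul_sub, ← mul_assoc, ← mul_assoc, hqb, mul_assoc b, this]; simp
    · have hk' : (0 : ℝ) < k := by exact_mod_cast hk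
      have h1 : ((k : ℝ)⁻¹ • (q * a)) ≤ 1 := by
        have := smul_le_smul_of_nonneg_left hqa (inv_nonneg.2 hk'.le)
        rwa [show (k : R) = (k : ℝ) • (1 : R) by simp [Algebra.smul_def],
          inv_smul_smul₀ hk'.ne'] at this
      have h2 := mul_comm_of_mem_unitInterval
        (smul_nonneg (inv_nonneg.2 hk'.le) (mul_nonneg q0 ha)) h1 hb
      rw [smul_mul_assoc, mul_smul_comm] at h2
      have h3 := smul_right_injective R (inv_ne_zero hk'.ne') h2
      rw [mul_sub, ← mul_assoc, ← mul_assoc, hqb, mul_assoc b, sub_eq_zero]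
      exact h3
  have h4 : (k : ℝ) • (a * b - b * a) = ((1 - q) * k) * (a * b - b * a) := by
    rw [← (Nat.cast_commute k (1 - q)).eq, mul_assoc, sub_mul, hc]
    simp [Algebra.smul_def]
  rw [h4]
  have h5 : 0 ≤ (1 - q) * k := mul_nonneg (sub_nonneg.2 q1) k.cast_nonneg
  exact (mul_le_mul_of_nonneg_left (sub_le_self _ (mul_nonneg hb ha)) h5).trans
    (mul_le_mul_of_nonneg_right (natCast_mul_one_sub_supportUnit_le ha k) (mul_nonneg ha hb))

/-- A Dedekind complete `f`-algebra with identity is commutative. -/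
theorem mul_comm_of_isFAlgebra (a b : R) : a * b = b * a := by
  have key : ∀ {x y : R}, 0 ≤ x → 0 ≤ y → Commute x y := fun hx hy =>
    le_antisymm (mul_le_mul_swap_of_nonneg hx hy) (mul_le_mul_swap_of_nonneg hy hx)
  rw [← posPart_sub_negPart_eq a, ← posPart_sub_negPart_eq b]
  exact ((key le_sup_right le_sup_right).sub_left (key le_sup_right le_sup_right)).sub_right
    ((key le_sup_right le_sup_right).sub_left (key le_sup_right le_sup_right))

end Support

end CVL

namespace CVL

/-! ### Uniqueness and existence of roots -/

section CommRing

variable {R : Type*} [CommRing R] [ConditionallyCompleteLattice R] [IsOrderedAddMonoid R]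
  [IsFAlgebra R]

theorem mul_eq_left_of_idempotent_le {p q : R} (hp0 : 0 ≤ p) (hp : p * p = p) (hpq : p ≤ q)
    (hq1 : q ≤ 1) : p * q = p := by
  refine le_antisymm (by simpa using mul_le_mul_of_nonneg_left hq1 hp0) ?_
  simpa [hp] using mul_le_mul_of_nonneg_left hpq hp0

theorem posPart_mul_self_eq (x : R) : (x ⊔ 0) * x = (x ⊔ 0) ^ 2 := by
  have e := mul_eq_zero_of_inf_eq_zero (posPart_inf_negPart x)
  have e2 := posPart_sub_negPart_eq x
  linear_combination -(x ⊔ 0) * e2 - e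

theorem pow_sub_pow_le {u v : R} (hv : 0 ≤ v) (hvu : v ≤ u) (hu : u ≤ 1) (n : ℕ) :
    u ^ n - v ^ n ≤ n * (u - v) := by
  induction n with
  | zero => simp
  | succ n ih =>
    have hu0 := hv.trans hvu
    have h1 : u * (u ^ n - v ^ n) ≤ u ^ n - v ^ n := by
      simpa using mul_le_mul_of_nonneg_right hu (sub_nonneg.2 (pow_le_pow_left₀ hv hvu n))
    have h2 : (u - v) * v ^ n ≤ u - v := by
      simpa using mul_le_mul_of_nonneg_left (pow_le_one₀ (n := n) hv (hvu.trans hu))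
        (sub_nonneg.2 hvu)
    calc u ^ (n + 1) - v ^ (n + 1) = u * (u ^ n - v ^ n) + (u - v) * v ^ n := by ring
      _ ≤ n * (u - v) + (u - v) := add_le_add (h1.trans ih) h2
      _ = _ := by push_cast; ring

variable [Algebra ℝ R]

/-- The cut-offs of `a` exhaust `1`: an element `y` living off all of them satisfies `k y ≤ a y` for
every `k`. -/
theorem eq_zero_of_supportUnit_natCast_sub_mul {a y : R} (ha : 0 ≤ a) (hy : 0 ≤ y)
    (h : ∀ k : ℕ, supportUnit ((k : R) - a) * y = 0) : y = 0 := by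
  refine le_antisymm (nonpos_of_forall_natCast_smul_le (y := a * y) fun k => ?_) hy
  have h1 := mul_le_mul_of_nonneg_right (natCast_mul_one_sub_supportUnit_le ha k) hy
  rw [Nat.cast_smul_eq_nsmul, nsmul_eq_mul]
  refine le_of_eq_of_le ?_ h1
  linear_combination (k : R) * h k

variable [PosSMulMono ℝ R]

theorem isReduced_of_isFAlgebra : IsReduced R := by
  have key : ∀ y : R, y ^ 2 = 0 → y ≤ 0 := by
    intro y hy
    refine nonpos_of_forall_natCast_smul_le (y := 1) fun n => ?_
    have h1 := mul_self_nonneg_of_isFAlgebra (1 - (n : R) * y)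
    have h2 : (1 - (n : R) * y) * (1 - (n : R) * y) = 1 - 2 * (n * y) := by
      linear_combination (n : R) ^ 2 * hy
    rw [h2, sub_nonneg] at h1
    rw [Nat.cast_smul_eq_nsmul, nsmul_eq_mul]
    -- As `y² = 0`, this square equals `4(1 - ny)`, whence `ny ≤ 1`.
    have h3 := mul_self_nonneg_of_isFAlgebra (2 - (n : R) * y)
    have h4 : (2 - (n : R) * y) * (2 - (n : R) * y) = 4 * (1 - n * y) := by
      linear_combination (n : R) ^ 2 * hy
    rw [h4] at h3
    have h5 := smul_nonneg (by norm_num : (0 : ℝ) ≤ 1 / 4) h3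
    rw [show (4 : R) = algebraMap ℝ R 4 by rw [map_ofNat], ← Algebra.smul_def, smul_smul] at h5
    norm_num at h5
    exact h5
  exact (isReduced_iff_pow_one_lt 2 one_lt_two).2 fun y hy =>
    le_antisymm (key y hy) (by simpa using key (-y) (by simpa using hy))

/-- Put `y = (a - b)⁺` and factor `aⁿ - bⁿ`. Since `y(a - b) = y²` and the cofactor dominates
`y^(n-1)`, this gives `y^(n+1) ≤ 0`, and `y = 0` by reducedness. -/
theorem le_of_pow_le_pow_of_isFAlgebra {a b : R} (ha : 0 ≤ a) (hb : 0 ≤ b) {n : ℕ} (hn : n ≠ 0)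
    (h : a ^ n ≤ b ^ n) : a ≤ b := by
  have : IsReduced R := isReduced_of_isFAlgebra
  obtain ⟨m, rfl⟩ := Nat.exists_eq_succ_of_ne_zero hn
  have hy0 : 0 ≤ (a - b) ⊔ 0 := le_sup_right
  have hya : (a - b) ⊔ 0 ≤ a := sup_le (sub_le_self a hb) ha
  have hyy : ((a - b) ⊔ 0) * (a - b) = ((a - b) ⊔ 0) ^ 2 := posPart_mul_self_eq _
  set y := (a - b) ⊔ 0
  have hg := Commute.mul_geom_sum₂ (Commute.all a b) (m + 1)
  have h1 : y ^ 2 * ∑ i ∈ Finset.range (m + 1), a ^ i * b ^ (m + 1 - 1 - i) ≤ 0 := by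
    rw [← hyy, mul_assoc, hg]
    exact mul_nonpos_of_nonneg_of_nonpos hy0 (sub_nonpos.2 h)
  have h2 : a ^ m ≤ ∑ i ∈ Finset.range (m + 1), a ^ i * b ^ (m + 1 - 1 - i) := by
    rw [Finset.sum_range_succ]
    simp only [Nat.add_sub_cancel, Nat.sub_self, pow_zero, mul_one]
    exact le_add_of_nonneg_left (Finset.sum_nonneg fun i _ =>
      mul_nonneg (pow_nonneg ha _) (pow_nonneg hb _))
  have h3 : y ^ (2 + m) ≤ 0 := by
    rw [pow_add]
    exact (mul_le_mul_of_nonneg_left ((pow_le_pow_left₀ hy0 hya m).trans h2)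
      (pow_nonneg hy0 2)).trans h1
  have h4 : y = 0 := eq_zero_of_pow_eq_zero (le_antisymm h3 (pow_nonneg hy0 _))
  exact sub_nonpos.1 (le_sup_left.trans_eq h4)

theorem eq_of_pow_eq_pow {a b : R} (ha : 0 ≤ a) (hb : 0 ≤ b) {n : ℕ} (hn : n ≠ 0)
    (h : a ^ n = b ^ n) : a = b :=
  le_antisymm (le_of_pow_le_pow_of_isFAlgebra ha hb hn h.le)
    (le_of_pow_le_pow_of_isFAlgebra hb ha hn h.ge)

theorem nthRoot_eq {n : ℕ} (hn : n ≠ 0) {a r : R} (hr : 0 ≤ r) (h : r ^ n = a) :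
    nthRoot n a = r := by
  have hex : ∃ r : R, IsNthRoot n a r := ⟨r, hr, h⟩
  rw [nthRoot, dif_pos hex]
  exact eq_of_pow_eq_pow hex.choose_spec.1 hr hn (hex.choose_spec.2.trans h.symm)

/-- Elements of `[0, 1]` have roots, found by an increasing fixed point iteration. -/
theorem exists_root_of_mem_unitInterval {a : R} (ha0 : 0 ≤ a) (ha1 : a ≤ 1) {n : ℕ} (hn : n ≠ 0) :
    ∃ r : R, 0 ≤ r ∧ r ^ n = a := by
  have hn' : (0 : ℝ) < n := by exact_mod_cast Nat.pos_of_ne_zero hn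
  have hc : ∀ x : R, (n : ℝ)⁻¹ • ((n : R) * x) = x := fun x => by
    rw [show (n : R) = algebraMap ℝ R n by simp, ← Algebra.smul_def, inv_smul_smul₀ hn'.ne']
  -- A fixed point `s` satisfies `(1 - s)^n = a`. Dividing by `n`, a Lipschitz constant of the power
  -- on `[0, 1]`, makes `T` increasing. It is also nonexpansive, so the supremum of the iterates is
  -- fixed.
  let T : R → R := fun x => (n : ℝ)⁻¹ • ((1 - x) ^ n - a + n * x)
  have hT : ∀ {x y : R}, 0 ≤ x → x ≤ y → y ≤ 1 → T x ≤ T y ∧ T y - T x ≤ y - x := by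
    intro x y hx hxy hy
    have e1 := pow_sub_pow_le (sub_nonneg.2 hy) (sub_le_sub_left hxy 1) (sub_le_self 1 hx) n
    have e2 := pow_le_pow_left₀ (sub_nonneg.2 hy) (sub_le_sub_left hxy 1) n
    constructor
    · refine smul_le_smul_of_nonneg_left ?_ (inv_nonneg.2 hn'.le)
      rw [← sub_nonneg] at e1 ⊢
      refine e1.trans_eq ?_
      ring
    · rw [← hc (y - x), ← smul_sub]
      refine smul_le_smul_of_nonneg_left ?_ (inv_nonneg.2 hn'.le)
      rw [← sub_nonneg] at e2 ⊢
      refine e2.trans_eq ?_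
      ring
  have hT0 : 0 ≤ T 0 := smul_nonneg (inv_nonneg.2 hn'.le) (by simpa using ha1)
  have hT1 : T 1 ≤ 1 := by
    have : T 1 ≤ (n : ℝ)⁻¹ • ((n : R) * 1) :=
      smul_le_smul_of_nonneg_left (by simpa [hn] using ha0) (inv_nonneg.2 hn'.le)
    rwa [hc] at this
  let x : ℕ → R := fun k => T^[k] 0
  have hxs : ∀ k, x (k + 1) = T (x k) := fun k => Function.iterate_succ_apply' T k 0
  have hx : ∀ k, 0 ≤ x k ∧ x k ≤ x (k + 1) ∧ x (k + 1) ≤ 1 := by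
    intro k
    induction k with
    | zero =>
      refine ⟨le_rfl, hT0, ?_⟩
      exact (hT le_rfl zero_le_one le_rfl).1.trans hT1
    | succ k ih =>
      obtain ⟨h0, h1, h2⟩ := ih
      refine ⟨h0.trans h1, ?_, ?_⟩
      · rw [hxs (k + 1)]
        conv_lhs => rw [hxs k]
        exact (hT h0 h1 h2).1
      · rw [hxs (k + 1)]
        exact (hT (h0.trans h1) h2 le_rfl).1.trans hT1
  have hxb : BddAbove (Set.range x) :=
    ⟨1, by rintro _ ⟨k, rfl⟩; exact (hx k).2.1.trans (hx k).2.2⟩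
  set s := ⨆ k, x k with hs
  have hxs' : ∀ k, x k ≤ s := le_ciSup hxb
  have s1 : s ≤ 1 := ciSup_le fun k => (hx k).2.1.trans (hx k).2.2
  have hfix : T s = s := by
    refine le_antisymm ?_ (ciSup_le fun k => ?_)
    · have : s ≤ s - (T s - s) := by
        refine ciSup_le fun k => ?_
        have e1 := (hT (hx k).1 (hxs' k) s1).2
        rw [← hxs] at e1
        have e2 := (sub_le_sub_left (hxs' (k + 1)) (T s)).trans e1
        exact le_sub_comm.1 e2
      simpa using this
    · refine (hx k).2.1.trans ?_
      rw [hxs]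
      exact (hT (hx k).1 (hxs' k) s1).1
  refine ⟨1 - s, sub_nonneg.2 s1, ?_⟩
  have h1 : (n : ℝ)⁻¹ • ((1 - s) ^ n - a + n * s) = (n : ℝ)⁻¹ • (n * s) := by
    rw [hc]; exact hfix
  have h2 := smul_right_injective R (inv_ne_zero hn'.ne') h1
  simpa [sub_eq_zero] using h2

theorem exists_root_of_le_natCast {a : R} (ha0 : 0 ≤ a) {k : ℕ} (hak : a ≤ k) {n : ℕ}
    (hn : n ≠ 0) : ∃ r : R, 0 ≤ r ∧ r ^ n = a := by
  -- Rescaling by `k + 1` instead of `k` avoids division by zero.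
  have hk : (0 : ℝ) < k + 1 := by positivity
  have h1 : ((k : ℝ) + 1)⁻¹ • a ≤ 1 := by
    have := smul_le_smul_of_nonneg_left (hak.trans (le_add_of_nonneg_right zero_le_one))
      (inv_nonneg.2 hk.le)
    rwa [show (k : R) + 1 = ((k : ℝ) + 1) • (1 : R) by simp [Algebra.smul_def],
      inv_smul_smul₀ hk.ne'] at this
  obtain ⟨r, hr0, hr⟩ := exists_root_of_mem_unitInterval
    (smul_nonneg (inv_nonneg.2 hk.le) ha0) h1 hn
  refine ⟨(((k : ℝ) + 1) ^ ((n : ℝ)⁻¹)) • r, smul_nonneg (by positivity) hr0, ?_⟩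
  rw [smul_pow, hr, Real.rpow_inv_natCast_pow hk.le hn, smul_inv_smul₀ hk.ne']

/-- If `q` is an increasing sequence of idempotents exhausting `1`, then a set is bounded above as
soon as it is bounded above on each `q n`. -/
theorem bddAbove_of_forall_mul_le [IsLaterallyComplete R] {q : ℕ → R} (hq0 : ∀ n, 0 ≤ q n)
    (hqm : Monotone q) (hq1 : ∀ n, q n ≤ 1) (hqq : ∀ n, q n * q n = q n)
    (hq : ∀ y, 0 ≤ y → (∀ n, q n * y = 0) → y = 0) {S : Set R}
    (hS : ∀ n, ∃ b, ∀ s ∈ S, q n * s ≤ b) : BddAbove S := by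
  have : IsReduced R := isReduced_of_isFAlgebra
  choose b hb using hS
  have hmul : ∀ {m n}, m ≤ n → q m * q n = q m := fun h =>
    mul_eq_left_of_idempotent_le (hq0 _) (hqq _) (hqm h) (hq1 _)
  -- The increments of `q` are pairwise disjoint idempotents. Lateral completeness supplies a
  -- supremum `t` of the bounds `b n ⊔ 0` cut down to them.
  let d : ℕ → R := fun n => q n - if n = 0 then 0 else q (n - 1)
  have hd0 : ∀ n, 0 ≤ d n := by
    intro n
    by_cases hn : n = 0
    · simpa [d, hn] using hq0 0
    · simpa [d, hn] using hqm (Nat.sub_le n 1)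
  have hdq : ∀ n, d n * q n = d n := by
    intro n
    by_cases hn : n = 0
    · simp [d, hn, hqq]
    · simp only [d, hn, if_false, sub_mul, hqq, hmul (Nat.sub_le n 1)]
  have hqd : ∀ {m n}, m < n → q m * d n = 0 := by
    intro m n h
    have hn : n ≠ 0 := by omega
    simp only [d, hn, if_false, mul_sub, hmul h.le, hmul (Nat.le_sub_one_of_lt h), sub_self]
  have hdd : ∀ n, d n * d n = d n := by
    intro n
    by_cases hn : n = 0
    · simp [d, hn, hqq]
    · have h1 := hqd (Nat.sub_lt (Nat.pos_of_ne_zero hn) one_pos)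
      have h2 : d n = q n - q (n - 1) := by simp [d, hn]
      calc d n * d n = d n * q n - q (n - 1) * d n := by rw [h2]; ring
        _ = d n := by rw [h1, hdq, sub_zero]
  have hdisj : ∀ {m n}, m < n → d m * d n = 0 := by
    intro m n h
    rw [← hdq m, mul_assoc, hqd h, mul_zero]
  have hdisj' : ∀ {m n}, m ≠ n → d m * d n = 0 := by
    intro m n h
    rcases lt_or_gt_of_ne h with h | h
    · exact hdisj h
    · rw [mul_comm]; exact hdisj h
  have hb0 : ∀ n, 0 ≤ d n * (b n ⊔ 0) := fun n => mul_nonneg (hd0 n) le_sup_right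
  obtain ⟨t, ht⟩ := IsLaterallyComplete.exists_isLUB (Set.range fun n => d n * (b n ⊔ 0))
    (Set.range_nonempty _) (by rintro _ ⟨n, rfl⟩; exact hb0 n) (by
      rintro _ ⟨m, rfl⟩ _ ⟨n, rfl⟩ hne
      have hmn : m ≠ n := by rintro rfl; exact hne rfl
      change d m * (b m ⊔ 0) ⊓ d n * (b n ⊔ 0) = 0
      have h0 : 0 ≤ d m * (b m ⊔ 0) ⊓ d n * (b n ⊔ 0) := le_inf (hb0 m) (hb0 n)
      refine eq_zero_of_pow_eq_zero (n := 2) (le_antisymm ?_ (pow_nonneg h0 2))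
      rw [pow_two]
      refine (mul_le_mul inf_le_left inf_le_right h0 (hb0 m)).trans_eq ?_
      linear_combination (b m ⊔ 0) * (b n ⊔ 0) * hdisj' hmn)
  refine ⟨t, fun s hs => ?_⟩
  have hy0 : 0 ≤ (s - t) ⊔ 0 := le_sup_right
  have hyy : ((s - t) ⊔ 0) * (s - t) = ((s - t) ⊔ 0) ^ 2 := posPart_mul_self_eq _
  set y := (s - t) ⊔ 0
  have hdst : ∀ n, d n * (s - t) ≤ 0 := by
    intro n
    have h1 : d n * s ≤ d n * (b n ⊔ 0) := by
      have := mul_le_mul_of_nonneg_left ((hb n s hs).trans le_sup_left : _ ≤ b n ⊔ 0) (hd0 n)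
      rwa [← mul_assoc, hdq] at this
    have h2 : d n * (b n ⊔ 0) ≤ d n * t := by
      have := mul_le_mul_of_nonneg_left (ht.1 ⟨n, rfl⟩) (hd0 n)
      rwa [← mul_assoc, hdd] at this
    rw [mul_sub]
    exact sub_nonpos.2 (h1.trans h2)
  -- The excess `y = (s - t)⁺` lives on no piece, hence on no `q n`.
  have hdy : ∀ n, d n * y ^ 2 = 0 := by
    intro n
    refine le_antisymm ?_ (mul_nonneg (hd0 n) (pow_nonneg hy0 2))
    rw [← hyy, mul_left_comm]
    exact mul_nonpos_of_nonneg_of_nonpos hy0 (hdst n)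
  have hqy : ∀ n, q n * y ^ 2 = 0 := by
    intro n
    induction n with
    | zero => simpa [d] using hdy 0
    | succ n ih =>
      have := hdy (n + 1)
      simp only [d, Nat.add_eq_zero_iff, one_ne_zero, and_false, if_false, Nat.add_sub_cancel,
        sub_mul, ih, sub_zero] at this
      exact this
  have h4 : y = 0 := eq_zero_of_pow_eq_zero (hq _ (pow_nonneg hy0 2) hqy)
  exact sub_nonpos.1 (le_sup_left.trans_eq h4)

variable [IsLaterallyComplete R]

/-- The roots `r k` of the bounded cut-offs `q k * a` are compatible by uniqueness, and bounded by
gluing. Their supremum restricts to `r k` on `q k`. -/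
theorem exists_root {a : R} (ha : 0 ≤ a) {n : ℕ} (hn : n ≠ 0) : ∃ r : R, 0 ≤ r ∧ r ^ n = a := by
  set q : ℕ → R := fun k => supportUnit ((k : R) - a) with hq
  have hq0 : ∀ k, 0 ≤ q k := fun k => supportUnit_nonneg _
  have hq1 : ∀ k, q k ≤ 1 := fun k => supportUnit_le_one _
  have hqq : ∀ k, q k * q k = q k := fun k => supportUnit_mul_self _
  have hqm : Monotone q := fun i j h =>
    supportUnit_mono (sub_le_sub_right (Nat.mono_cast h) a)
  have hqy : ∀ y, 0 ≤ y → (∀ n, q n * y = 0) → y = 0 := fun y hy h =>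
    eq_zero_of_supportUnit_natCast_sub_mul ha hy h
  have hmul : ∀ {i j}, i ≤ j → q i * q j = q i := fun h =>
    mul_eq_left_of_idempotent_le (hq0 _) (hqq _) (hqm h) (hq1 _)
  have hex : ∀ k, ∃ r : R, 0 ≤ r ∧ r ^ n = q k * a := fun k =>
    exists_root_of_le_natCast (mul_nonneg (hq0 k) ha)
      ((supportUnit_natCast_sub_mul_le a k).trans (by
        simpa using mul_le_mul_of_nonneg_right (hq1 k) (k.cast_nonneg : (0 : R) ≤ k))) hn
  choose r hr0 hr using hex
  have hqpow : ∀ k, q k ^ n = q k := fun k => IsIdempotentElem.pow_eq (hqq k) hn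
  have hqr : ∀ {i j}, i ≤ j → q i * r j = r i := by
    intro i j h
    refine eq_of_pow_eq_pow (mul_nonneg (hq0 i) (hr0 j)) (hr0 i) hn ?_
    rw [mul_pow, hqpow, hr, hr, ← mul_assoc, hmul h]
  have hrm : Monotone r := by
    intro i j h
    rw [← hqr h]
    simpa using mul_le_mul_of_nonneg_right (hq1 i) (hr0 j)
  have hb : BddAbove (Set.range r) := by
    refine bddAbove_of_forall_mul_le hq0 hqm hq1 hqq hqy fun i => ⟨r i, ?_⟩
    rintro _ ⟨j, rfl⟩
    rcases le_total i j with h | h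
    · exact (hqr h).le
    · refine le_trans ?_ (hrm h)
      simpa using mul_le_mul_of_nonneg_right (hq1 i) (hr0 j)
  set s := ⨆ k, r k
  have hrs : ∀ k, r k ≤ s := le_ciSup hb
  have hs0 : 0 ≤ s := (hr0 0).trans (hrs 0)
  have hqs : ∀ i, q i * s = r i := by
    intro i
    refine le_antisymm ?_ ?_
    -- For `m ≥ i` the element `r m` splits into `q i * r m = r i` and a part off `q i`.
    · have : s ≤ r i + (1 - q i) * s := by
        refine ciSup_le fun j => ?_
        have h1 : r j ≤ r (max i j) := hrm (le_max_right _ _)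
        have h2 := mul_le_mul_of_nonneg_left (hrs (max i j)) (sub_nonneg.2 (hq1 i))
        have h3 := hqr (le_max_left i j)
        refine h1.trans ?_
        rw [← h3]
        refine le_of_eq_of_le ?_ (add_le_add_right h2 _)
        ring
      rw [sub_mul, one_mul, add_sub, le_sub_iff_add_le, add_comm, add_le_add_iff_right] at this
      exact this
    · have := mul_le_mul_of_nonneg_left (hrs i) (hq0 i)
      rwa [hqr le_rfl] at this
  refine ⟨s, hs0, ?_⟩
  have hz : ∀ i, q i * (s ^ n - a) = 0 := by
    intro i
    rw [mul_sub, sub_eq_zero, ← hr i, ← hqs i, mul_pow, hqpow]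
  have : IsReduced R := isReduced_of_isFAlgebra
  have h2 := hqy ((s ^ n - a) * (s ^ n - a)) (mul_self_nonneg_of_isFAlgebra _) fun i => by
    rw [← mul_assoc, hz, zero_mul]
  exact sub_eq_zero.1 (eq_zero_of_pow_eq_zero (n := 2) (by rw [pow_two, h2]))

theorem nthRoot_nonneg {a : R} (ha : 0 ≤ a) {n : ℕ} (hn : n ≠ 0) : 0 ≤ nthRoot n a := by
  obtain ⟨r, hr, h⟩ := exists_root ha hn
  rwa [nthRoot_eq hn hr h]

theorem nthRoot_pow {a : R} (ha : 0 ≤ a) {n : ℕ} (hn : n ≠ 0) : nthRoot n a ^ n = a := by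
  obtain ⟨r, hr, h⟩ := exists_root ha hn
  rwa [nthRoot_eq hn hr h]

end CommRing

end CVL

namespace CVL

open Complexification

/-! ### Modulus and order convergence -/

section Modulus

variable {R : Type*} [AddCommGroup R]

theorem ofReal_sub (x y : R) : ofReal (x - y) = ofReal x - ofReal y := by
  ext <;> simp [ofReal]

theorem ofReal_sum (f : ℕ → R) (n : ℕ) :
    ∑ i ∈ Finset.range n, ofReal (f i) = ofReal (∑ i ∈ Finset.range n, f i) := by
  induction n with
  | zero => rfl
  | succ n ih =>
    rw [Finset.sum_range_succ, ih, Finset.sum_range_succ]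
    ext <;> simp [ofReal]

variable [Module ℝ R] [ConditionallyCompleteLattice R]

theorem modulus_le {z : Complexification R} {y : R}
    (h : ∀ θ ∈ Set.Icc 0 (2 * Real.pi), Real.cos θ • z.re + Real.sin θ • z.im ≤ y) :
    modulus z ≤ y :=
  csSup_le ⟨_, 0, ⟨le_rfl, by positivity⟩, rfl⟩ (by rintro _ ⟨θ, hθ, rfl⟩; exact h θ hθ)

variable [IsOrderedAddMonoid R] [PosSMulMono ℝ R]

theorem smul_le_abs {c : ℝ} (hc : |c| ≤ 1) (x : R) : c • x ≤ |x| := by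
  obtain ⟨h1, h2⟩ := abs_le.1 hc
  have e1 := smul_nonneg (sub_nonneg.2 h2) (posPart_nonneg x)
  have e2 := smul_nonneg (neg_le_iff_add_nonneg.1 h1) (negPart_nonneg x)
  have e3 := add_nonneg e1 e2
  rw [← sub_nonneg]
  calc (0 : R) ≤ (1 - c) • x⁺ + (c + 1) • x⁻ := by simpa using e3
    _ = (x⁺ + x⁻) - c • (x⁺ - x⁻) := by module
    _ = |x| - c • x := by rw [posPart_add_negPart, posPart_sub_negPart]

theorem cos_smul_add_sin_smul_le (z : Complexification R) (θ : ℝ) :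
    Real.cos θ • z.re + Real.sin θ • z.im ≤ |z.re| + |z.im| :=
  add_le_add (smul_le_abs (Real.abs_cos_le_one θ) _) (smul_le_abs (Real.abs_sin_le_one θ) _)

theorem le_modulus (z : Complexification R) {θ : ℝ} (h : θ ∈ Set.Icc 0 (2 * Real.pi)) :
    Real.cos θ • z.re + Real.sin θ • z.im ≤ modulus z :=
  le_csSup ⟨|z.re| + |z.im|, by rintro _ ⟨θ, -, rfl⟩; exact cos_smul_add_sin_smul_le z θ⟩
    ⟨θ, h, rfl⟩

theorem abs_re_le_modulus (z : Complexification R) : |z.re| ≤ modulus z := by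
  refine abs_le'.2 ⟨?_, ?_⟩
  · simpa using le_modulus z (θ := 0) ⟨le_rfl, by positivity⟩
  · simpa using le_modulus z (θ := Real.pi) ⟨by positivity, by linarith [Real.pi_pos]⟩

theorem modulus_nonneg (z : Complexification R) : 0 ≤ modulus z :=
  (abs_nonneg _).trans (abs_re_le_modulus z)

theorem modulus_ofReal (x : R) : modulus (ofReal x) = |x| := by
  refine le_antisymm (modulus_le fun θ _ => ?_) (abs_re_le_modulus (ofReal x))
  simpa [ofReal] using cos_smul_add_sin_smul_le (ofReal x) θ

theorem modulus_sub_le (z w : Complexification R) :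
    modulus (z - w) ≤ modulus z + modulus w := by
  refine modulus_le fun θ hθ => ?_
  have h1 := le_modulus z hθ
  -- Turning `θ` by `π`, in the direction that stays within `[0, 2π]`, changes the sign.
  have h2 : -(Real.cos θ • w.re + Real.sin θ • w.im) ≤ modulus w := by
    rcases le_total θ Real.pi with h | h
    · have := le_modulus w (θ := θ + Real.pi)
        ⟨by linarith [hθ.1, Real.pi_pos], by linarith⟩
      refine le_of_eq_of_le ?_ this
      rw [Real.cos_add_pi, Real.sin_add_pi]; module
    · have := le_modulus w (θ := θ - Real.pi) ⟨by linarith, by linarith [hθ.2, Real.pi_pos]⟩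
      refine le_of_eq_of_le ?_ this
      rw [Real.cos_sub_pi, Real.sin_sub_pi]; module
  refine le_of_eq_of_le ?_ (add_le_add h1 h2)
  simp only [sub_re, sub_im]
  module

/-- A term is the difference of two consecutive errors of the partial sums, and `p` decreases. -/
theorem SeriesConverges.exists_modulus_le {a : ℕ → Complexification R} (h : SeriesConverges a) :
    ∃ p : ℕ → R, Antitone p ∧ IsGLB (Set.range p) 0 ∧ ∀ n, modulus (a (n + 1)) ≤ p n + p n := by
  obtain ⟨s, p, hp, hp0, hs⟩ := h
  refine ⟨p, hp, hp0, fun n => ?_⟩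
  have h1 := modulus_sub_le (∑ i ∈ Finset.range (n + 1 + 1), a i - s)
    (∑ i ∈ Finset.range (n + 1), a i - s)
  rw [sub_sub_sub_cancel_right, Finset.sum_range_succ, add_sub_cancel_left,
    ← Finset.sum_range_succ] at h1
  exact h1.trans (add_le_add ((hs (n + 1)).trans (hp n.le_succ)) (hs n))

theorem SeriesConverges.nonpos_of_le_modulus {a : ℕ → Complexification R} (h : SeriesConverges a)
    {y : R} (hy : ∀ n, y ≤ modulus (a (n + 1))) : y ≤ 0 := by
  obtain ⟨p, -, hp0, hp⟩ := h.exists_modulus_le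
  have h1 : (2⁻¹ : ℝ) • y ≤ 0 := by
    refine hp0.2 ?_
    rintro _ ⟨n, rfl⟩
    have := smul_le_smul_of_nonneg_left ((hy n).trans (hp n)) (by norm_num : (0 : ℝ) ≤ 2⁻¹)
    refine this.trans_eq ?_
    module
  have h2 := smul_le_smul_of_nonneg_left h1 (by norm_num : (0 : ℝ) ≤ 2)
  simpa using h2

theorem seriesConverges_ofReal {b : ℕ → R} (hb : ∀ n, 0 ≤ b n)
    (h : BddAbove (Set.range fun m => ∑ i ∈ Finset.range (m + 1), b i)) :
    SeriesConverges fun n => ofReal (b n) := by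
  set S : ℕ → R := fun m => ∑ i ∈ Finset.range (m + 1), b i with hS
  have hmono : Monotone S := monotone_nat_of_le_succ fun n => by
    simp only [hS]
    rw [Finset.sum_range_succ _ (n + 1)]
    exact le_add_of_nonneg_right (hb _)
  refine ⟨ofReal (⨆ m, S m), fun m => (⨆ m, S m) - S m,
    fun i j hij => sub_le_sub_left (hmono hij) _, ⟨?_, ?_⟩, fun m => ?_⟩
  · rintro _ ⟨m, rfl⟩
    exact sub_nonneg.2 (le_ciSup h m)
  · intro y hy
    have : (⨆ m, S m) ≤ (⨆ m, S m) - y :=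
      ciSup_le fun m => le_sub_comm.1 (hy ⟨m, rfl⟩)
    simpa using this
  · beta_reduce
    rw [ofReal_sum, ← ofReal_sub, modulus_ofReal, abs_sub_comm,
      abs_of_nonneg (sub_nonneg.2 (le_ciSup h m))]

end Modulus

/-! ### Order limit superior -/

section Limsup

variable {R : Type*} [ConditionallyCompleteLattice R] {x : ℕ → R}

theorem OrderBounded.bddAbove_tail (h : OrderBounded x) (n : ℕ) :
    BddAbove (Set.range fun k => x (n + k)) :=
  h.2.mono (by rintro _ ⟨k, rfl⟩; exact ⟨_, rfl⟩)

theorem OrderBounded.antitone_iSup_tail (h : OrderBounded x) :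
    Antitone fun n => ⨆ k, x (n + k) := fun i j hij => by
  refine ciSup_le fun k => ?_
  have := le_ciSup (h.bddAbove_tail i) (j - i + k)
  rwa [show i + (j - i + k) = j + k by omega] at this

theorem OrderBounded.bddBelow_iSup_tail (h : OrderBounded x) :
    BddBelow (Set.range fun n => ⨆ k, x (n + k)) := by
  obtain ⟨y, hy⟩ := h.1
  exact ⟨y, by rintro _ ⟨n, rfl⟩; exact le_ciSup_of_le (h.bddAbove_tail n) 0 (hy ⟨_, rfl⟩)⟩

theorem OrderBounded.orderLimsup_le_iSup (h : OrderBounded x) (n : ℕ) :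
    orderLimsup x ≤ ⨆ k, x (n + k) :=
  ciInf_le h.bddBelow_iSup_tail n

theorem orderLimsup_of_antitone (h : Antitone x) (hb : OrderBounded x) :
    orderLimsup x = ⨅ n, x n := by
  unfold orderLimsup
  congr 1
  funext n
  exact le_antisymm (ciSup_le fun k => h (Nat.le_add_right n k)) (le_ciSup (hb.bddAbove_tail n) 0)

theorem orderLimsup_const (c : R) : orderLimsup (fun _ => c) = c := by
  simp [orderLimsup]

end Limsup

theorem not_muchLess_self {R : Type*} [AddCommGroup R] [Lattice R] [IsOrderedAddMonoid R]
    [Nontrivial R] (x : R) : ¬ MuchLess x x := by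
  intro h
  obtain ⟨y, hy⟩ := exists_ne (0 : R)
  exact hy (h.2 y (by simp))

/-- The term of index `0` needs no exception, because `1 / 0 = 0`. -/
theorem inverseSquares_eq {R : Type*} [Ring R] [Algebra ℝ R] :
    inverseSquares R = fun n : ℕ => ofReal (((1 : ℝ) / (n : ℝ) ^ 2) • (1 : R)) := by
  funext n
  by_cases hn : n = 0
  · subst hn
    simp [inverseSquares, ofReal, Complexification.ext_iff]
  · simp [inverseSquares, hn]

/-! ### The root test and the inconclusive case -/

section Tests

variable {R : Type*} [CommRing R] [Algebra ℝ R] [ConditionallyCompleteLattice R]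
  [IsOrderedAddMonoid R] [PosSMulMono ℝ R] [IsFAlgebra R]

theorem rootSeq_eq {a : ℕ → Complexification R} {k : ℕ} {r : R} (hr : 0 ≤ r)
    (h : r ^ (k + 1) = modulus (a (k + 1))) : rootSeq a k = r :=
  nthRoot_eq k.succ_ne_zero hr h

section InverseSquares

theorem rootSeq_inverseSquares (k : ℕ) :
    rootSeq (inverseSquares R) k =
      ((((k : ℝ) + 1) ^ ((1 : ℝ) / ((k : ℝ) + 1))) ^ 2)⁻¹ • (1 : R) := by
  refine rootSeq_eq (smul_nonneg (by positivity) zero_le_one) ?_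
  rw [inverseSquares_eq, modulus_ofReal, abs_of_nonneg (smul_nonneg (by positivity) zero_le_one),
    smul_pow, one_pow, inv_pow, ← pow_mul, mul_comm 2, pow_mul, one_div ((k : ℝ) + 1)]
  have := Real.rpow_inv_natCast_pow (by positivity : (0 : ℝ) ≤ (k : ℝ) + 1) k.succ_ne_zero
  push_cast at this ⊢
  rw [this, one_div]

theorem rootSeq_inverseSquares_nonneg (k : ℕ) : 0 ≤ rootSeq (inverseSquares R) k := by
  rw [rootSeq_inverseSquares]
  exact smul_nonneg (by positivity) zero_le_one

theorem rootSeq_inverseSquares_le_one (k : ℕ) : rootSeq (inverseSquares R) k ≤ 1 := by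
  rw [rootSeq_inverseSquares]
  have h : (1 : ℝ) ≤ ((k : ℝ) + 1) ^ ((1 : ℝ) / ((k : ℝ) + 1)) :=
    Real.one_le_rpow (by linarith [(k.cast_nonneg : (0 : ℝ) ≤ k)]) (by positivity)
  have h1 : ((((k : ℝ) + 1) ^ ((1 : ℝ) / ((k : ℝ) + 1))) ^ 2)⁻¹ ≤ 1 :=
    inv_le_one_of_one_le₀ (one_le_pow₀ h)
  simpa using smul_le_smul_of_scalar_le h1 (zero_le_one : (0 : R) ≤ 1)

theorem orderBounded_rootSeq_inverseSquares : OrderBounded (rootSeq (inverseSquares R)) :=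
  ⟨⟨0, by rintro _ ⟨k, rfl⟩; exact rootSeq_inverseSquares_nonneg k⟩,
    ⟨1, by rintro _ ⟨k, rfl⟩; exact rootSeq_inverseSquares_le_one k⟩⟩

theorem orderLimsup_rootSeq_inverseSquares : orderLimsup (rootSeq (inverseSquares R)) = 1 := by
  have hb := orderBounded_rootSeq_inverseSquares (R := R)
  refine le_antisymm ((hb.orderLimsup_le_iSup 0).trans
    (ciSup_le fun k => rootSeq_inverseSquares_le_one _)) ?_
  refine le_ciInf fun n => sub_nonpos.1 (nonpos_of_forall_le_smul (y := 1) fun m => ?_)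
  -- Every tail contains a root above `1 - 1/(m+1)`, since the real coefficients tend to `1`.
  have hlim : Filter.Tendsto (fun k : ℕ => ((((k : ℝ) + 1) ^ ((1 : ℝ) / ((k : ℝ) + 1))) ^ 2)⁻¹)
      Filter.atTop (nhds 1) := by
    have h1 : Filter.Tendsto (fun k : ℕ => (k : ℝ) + 1) Filter.atTop Filter.atTop :=
      Filter.tendsto_atTop_add_const_right _ _ tendsto_natCast_atTop_atTop
    have h2 := ((tendsto_rpow_div.comp h1).pow 2).inv₀ (by norm_num)
    simpa using h2
  have hpos : (0 : ℝ) < ((m : ℝ) + 1)⁻¹ := by positivity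
  obtain ⟨k, hk, hkn⟩ := ((hlim.eventually_const_le (sub_lt_self 1 hpos)).and
    (Filter.eventually_ge_atTop n)).exists
  have h3 : rootSeq (inverseSquares R) k ≤ ⨆ j, rootSeq (inverseSquares R) (n + j) := by
    have := le_ciSup (hb.bddAbove_tail n) (k - n)
    rwa [Nat.add_sub_cancel' hkn] at this
  rw [rootSeq_inverseSquares] at h3
  have h4 := (smul_le_smul_of_scalar_le hk (zero_le_one : (0 : R) ≤ 1)).trans h3
  rw [sub_smul, one_smul] at h4
  exact sub_le_comm.1 h4

theorem seriesConverges_inverseSquares : SeriesConverges (inverseSquares R) := by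
  rw [inverseSquares_eq]
  refine seriesConverges_ofReal (fun n => smul_nonneg (by positivity) zero_le_one)
    ⟨(∑' n : ℕ, (1 : ℝ) / (n : ℝ) ^ 2) • (1 : R), ?_⟩
  rintro _ ⟨m, rfl⟩
  simp only [← Finset.sum_smul]
  exact smul_le_smul_of_scalar_le ((Real.summable_one_div_nat_pow.2 one_lt_two).sum_le_tsum _
    fun n _ => by positivity) zero_le_one

end InverseSquares

theorem rootSeq_one : rootSeq (fun _ => ofReal (1 : R)) = fun _ => 1 := by
  funext k
  refine rootSeq_eq zero_le_one ?_
  rw [modulus_ofReal, abs_of_nonneg zero_le_one, one_pow]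

theorem not_seriesConverges_one [Nontrivial R] :
    ¬ SeriesConverges (fun _ => ofReal (1 : R)) := by
  intro h
  have h1 := h.nonpos_of_le_modulus (y := 1) fun _ => by
    rw [modulus_ofReal]; exact le_abs_self 1
  exact one_ne_zero (le_antisymm h1 zero_le_one)

variable [IsLaterallyComplete R]

theorem rootSeq_nonneg (a : ℕ → Complexification R) (k : ℕ) : 0 ≤ rootSeq a k :=
  nthRoot_nonneg (modulus_nonneg _) k.succ_ne_zero

theorem rootSeq_pow (a : ℕ → Complexification R) (k : ℕ) :
    rootSeq a k ^ (k + 1) = modulus (a (k + 1)) :=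
  nthRoot_pow (modulus_nonneg _) k.succ_ne_zero

theorem SeriesConverges.rootSeq_bounds {a : ℕ → Complexification R} (h : SeriesConverges a) :
    OrderBounded (rootSeq a) ∧ orderLimsup (rootSeq a) ≤ 1 := by
  obtain ⟨p, hp, hp0, hpa⟩ := h.exists_modulus_le
  set c := p 0 + p 0 with hc
  have hc0 : 0 ≤ c := add_nonneg (hp0.1 ⟨0, rfl⟩) (hp0.1 ⟨0, rfl⟩)
  have key : ∀ k, rootSeq a k ≤ 1 + ((k : ℝ) + 1)⁻¹ • c := by
    intro k
    have hk : (0 : ℝ) < (k : ℝ) + 1 := by positivity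
    have hd : 0 ≤ ((k : ℝ) + 1)⁻¹ • c := smul_nonneg (inv_nonneg.2 hk.le) hc0
    refine le_of_pow_le_pow_of_isFAlgebra (rootSeq_nonneg a k) (add_nonneg zero_le_one hd)
      k.succ_ne_zero ?_
    rw [rootSeq_pow]
    have h1 : modulus (a (k + 1)) ≤ c :=
      (hpa k).trans (add_le_add (hp k.zero_le) (hp k.zero_le))
    -- Bernoulli: `(1 + c/(k+1))^(k+1) ≥ 1 + c ≥ c`.
    have h2 := one_add_mul_le_pow_of_sq_nonneg (pow_nonneg hd 2)
      (pow_nonneg (add_nonneg zero_le_one hd) 2)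
      (add_nonneg zero_le_two hd) (k + 1)
    refine (h1.trans ?_).trans h2
    rw [show ((k + 1 : ℕ) : R) = algebraMap ℝ R ((k : ℝ) + 1) by simp, ← Algebra.smul_def,
      smul_inv_smul₀ hk.ne']
    exact le_add_of_nonneg_left zero_le_one
  have key' : ∀ n k, n ≤ k → rootSeq a k ≤ 1 + ((n : ℝ) + 1)⁻¹ • c := by
    intro n k hnk
    refine (key k).trans (add_le_add_right (smul_le_smul_of_scalar_le ?_ hc0) _)
    gcongr
  have hb : OrderBounded (rootSeq a) :=
    ⟨⟨0, by rintro _ ⟨k, rfl⟩; exact rootSeq_nonneg a k⟩,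
      ⟨_, by rintro _ ⟨k, rfl⟩; exact key' 0 k k.zero_le⟩⟩
  refine ⟨hb, sub_nonpos.1 (nonpos_of_forall_le_smul (y := c) fun n => ?_)⟩
  rw [sub_le_iff_le_add']
  exact (hb.orderLimsup_le_iSup n).trans (ciSup_le fun k => key' n _ (Nat.le_add_right n k))

theorem seriesConvergesAbsolutely_of_orderLimsup_muchLess {a : ℕ → Complexification R}
    (hb : OrderBounded (rootSeq a)) (hL : MuchLess (orderLimsup (rootSeq a)) 1) :
    SeriesConvergesAbsolutely a := by
  have : IsReduced R := isReduced_of_isFAlgebra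
  set v : ℕ → R := fun n => ⨆ k, rootSeq a (n + k) with hv
  have hvm : Antitone v := hb.antitone_iSup_tail
  have hinv : ∀ {i j : ℕ}, i ≤ j → ((j : ℝ) + 1)⁻¹ • (1 : R) ≤ ((i : ℝ) + 1)⁻¹ • (1 : R) :=
    fun h => smul_le_smul_of_scalar_le (by gcongr) zero_le_one
  -- Where `x n` is positive, all roots from entry `n` on are below `1 - 1/(n+1)`. The `x n`
  -- increase, and their positive parts have supremum at least `(1 - L)⁺`, a weak order unit; so
  -- their supports exhaust `1`.
  set x : ℕ → R := fun n => 1 - ((n : ℝ) + 1)⁻¹ • (1 : R) - v n with hx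
  have hxm : Monotone x := fun i j h => sub_le_sub (sub_le_sub_left (hinv h) _) (hvm h)
  have hxb : BddAbove (Set.range fun n => x n ⊔ 0) := by
    refine ⟨1, ?_⟩
    rintro _ ⟨n, rfl⟩
    refine sup_le ?_ zero_le_one
    have h1 : 0 ≤ v n := le_ciSup_of_le (hb.bddAbove_tail n) 0 (rootSeq_nonneg a _)
    exact (sub_le_self _ h1).trans (sub_le_self _ (smul_nonneg (by positivity) zero_le_one))
  have hsup : (1 - orderLimsup (rootSeq a)) ⊔ 0 ≤ ⨆ n, x n ⊔ 0 := by
    refine sup_le ?_ (le_ciSup_of_le hxb 0 le_sup_right)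
    rw [sub_le_comm]
    refine le_ciInf fun n => sub_nonpos.1 (nonpos_of_forall_le_smul (y := 1) fun m => ?_)
    have h1 : x (max m n) ≤ ⨆ n, x n ⊔ 0 := le_ciSup_of_le hxb (max m n) le_sup_left
    have h2 := hinv (le_max_left m n)
    have h3 := hvm (le_max_right m n)
    have h4 := add_le_add (add_le_add h1 h2) h3
    rw [← sub_nonneg] at h4 ⊢
    refine h4.trans_eq ?_
    simp only [hx, hv]
    ring
  refine seriesConverges_ofReal (fun n => modulus_nonneg _) ?_
  refine bddAbove_of_forall_mul_le (q := fun n => supportUnit (x n))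
    (fun n => supportUnit_nonneg _) (fun i j h => supportUnit_mono (hxm h))
    (fun n => supportUnit_le_one _) (fun n => supportUnit_mul_self _) ?_ ?_
  · intro y hy hqy
    have h1 : ∀ n, (x n ⊔ 0) ⊓ y = 0 := by
      intro n
      have h0 : 0 ≤ (x n ⊔ 0) ⊓ y := le_inf le_sup_right hy
      refine eq_zero_of_pow_eq_zero (n := 2) (le_antisymm ?_ (pow_nonneg h0 2))
      rw [pow_two]
      refine (mul_le_mul inf_le_left inf_le_right h0 le_sup_right).trans_eq ?_
      rw [← supportUnit_mul, mul_right_comm, hqy, zero_mul]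
    have h2 := ciSup_inf_eq_zero hxb (fun n => le_sup_right) hy h1
    refine hL.2 y ?_
    rw [abs_of_nonneg hy, inf_comm]
    exact inf_eq_zero_of_le h2 le_sup_right hy hsup le_rfl
  · intro n
    set q := supportUnit (x n)
    have q0 : 0 ≤ q := supportUnit_nonneg _
    have q1 : q ≤ 1 := supportUnit_le_one _
    set ρ : ℝ := 1 - ((n : ℝ) + 1)⁻¹ with hρ
    have hρ0 : 0 ≤ ρ := by
      rw [hρ, sub_nonneg]
      exact inv_le_one_of_one_le₀ (by linarith [(n.cast_nonneg : (0 : ℝ) ≤ n)])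
    have hρ1 : ρ < 1 := sub_lt_self _ (by positivity)
    have hqv : q * v n ≤ ρ • (1 : R) := by
      have h1 : 0 ≤ q * (ρ • (1 : R) - v n) := by
        have := supportUnit_mul_nonneg (x n)
        simpa [hx, hρ, sub_smul] using this
      rw [mul_sub, sub_nonneg] at h1
      refine h1.trans ?_
      simpa using mul_le_mul_of_nonneg_right q1 (smul_nonneg hρ0 (zero_le_one : (0 : R) ≤ 1))
    have hterm : ∀ i, q * modulus (a i) ≤
        (if i < n + 1 then modulus (a i) else 0) + ρ ^ i • (1 : R) := by
      intro i
      have hρi : 0 ≤ ρ ^ i • (1 : R) := smul_nonneg (pow_nonneg hρ0 i) zero_le_one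
      by_cases hi : i < n + 1
      · rw [if_pos hi]
        refine le_add_of_le_of_nonneg ?_ hρi
        simpa using mul_le_mul_of_nonneg_right q1 (modulus_nonneg (a i))
      · rw [if_neg hi, zero_add]
        -- Entry `n + k` of `rootSeq` is the root of the term of index `n + k + 1`.
        obtain ⟨k, rfl⟩ : ∃ k, i = n + k + 1 := ⟨i - (n + 1), by omega⟩
        have h1 : rootSeq a (n + k) ≤ v n := le_ciSup (hb.bddAbove_tail n) k
        have h2 := (mul_le_mul_of_nonneg_left h1 q0).trans hqv
        have h3 := pow_le_pow_left₀ (mul_nonneg q0 (rootSeq_nonneg a _)) h2 (n + k + 1)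
        rwa [mul_pow, rootSeq_pow, IsIdempotentElem.pow_eq (supportUnit_mul_self _)
          (n + k).succ_ne_zero, smul_pow, one_pow] at h3
    refine ⟨∑ i ∈ Finset.range (n + 1), modulus (a i) + (∑' i : ℕ, ρ ^ i) • (1 : R), ?_⟩
    rintro _ ⟨m, rfl⟩
    simp only [Finset.mul_sum]
    refine (Finset.sum_le_sum fun i _ => hterm i).trans ?_
    rw [Finset.sum_add_distrib, ← Finset.sum_smul]
    refine add_le_add ?_ (smul_le_smul_of_scalar_le
      ((summable_geometric_of_lt_one hρ0 hρ1).sum_le_tsum _ fun i _ => pow_nonneg hρ0 i)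
      zero_le_one)
    rw [← Finset.sum_filter]
    refine Finset.sum_le_sum_of_subset_of_nonneg (fun i hi => ?_) fun i _ _ => modulus_nonneg _
    exact Finset.mem_range.2 (Finset.mem_filter.1 hi).2

end Tests

/-! ### The disk series in `ℂ^ℂ` -/

section Functions

instance isLaterallyComplete_fun {ι : Type*} : IsLaterallyComplete (ι → ℝ) where
  exists_isLUB S hne h0 hd := by
    refine ⟨fun i => sSup ((fun x : ι → ℝ => x i) '' S), isLUB_pi.2 fun i => ?_⟩
    refine isLUB_csSup (hne.image _) ?_
    -- At each point at most one member of a disjoint family is positive, and its value bounds the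
    -- others.
    by_cases h : ∃ x ∈ S, 0 < x i
    · obtain ⟨x, hx, hxi⟩ := h
      refine ⟨x i, ?_⟩
      rintro _ ⟨y, hy, rfl⟩
      by_cases hxy : x = y
      · rw [hxy]
      · have h1 : min (x i) (y i) = 0 := congrFun (hd hx hy hxy) i
        have h2 : y i ≤ 0 := by
          by_contra! h3
          exact (lt_min hxi h3).ne' h1
        exact h2.trans hxi.le
    · push Not at h
      exact ⟨0, by rintro _ ⟨y, hy, rfl⟩; exact h y hy⟩

instance isFAlgebra_fun {ι : Type*} : IsFAlgebra (ι → ℝ) where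
  mul_nonneg a b ha hb i := mul_nonneg (ha i) (hb i)
  mul_left_inf a b c h hc := by
    funext i
    have h1 : min (a i) (b i) = 0 := congrFun h i
    have h2 := hc i
    change min (c i * a i) (b i) = 0
    rcases min_choice (a i) (b i) with h3 | h3 <;> rw [h3] at h1
    · rw [h1, mul_zero]
      exact min_eq_left (by rw [← h1, ← h3]; exact min_le_right _ _)
    · rw [h1]
      exact min_eq_right (mul_nonneg h2 (by rw [← h1, ← h3]; exact min_le_left _ _))
  mul_right_inf a b c h hc := by
    funext i
    have h1 : min (a i) (b i) = 0 := congrFun h i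
    have h2 := hc i
    change min (a i * c i) (b i) = 0
    rcases min_choice (a i) (b i) with h3 | h3 <;> rw [h3] at h1
    · rw [h1, zero_mul]
      exact min_eq_left (by rw [← h1, ← h3]; exact min_le_right _ _)
    · rw [h1]
      exact min_eq_right (mul_nonneg (by rw [← h1, ← h3]; exact min_le_left _ _) h2)

theorem diskSeries_succ (k : ℕ) : diskSeries (k + 1) =
    ofReal ((Metric.closedBall (0 : ℂ) (1 / ((k : ℝ) + 1))).indicator fun _ => (1 : ℝ)) := by
  simp [diskSeries]

theorem indicator_one_nonneg (s : Set ℂ) : (0 : ℂ → ℝ) ≤ s.indicator fun _ => (1 : ℝ) :=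
  fun _ => Set.indicator_nonneg (fun _ _ => zero_le_one) _

theorem modulus_diskSeries_succ (k : ℕ) : modulus (diskSeries (k + 1)) =
    (Metric.closedBall (0 : ℂ) (1 / ((k : ℝ) + 1))).indicator fun _ => (1 : ℝ) := by
  rw [diskSeries_succ, modulus_ofReal, abs_of_nonneg (indicator_one_nonneg _)]

theorem rootSeq_diskSeries : rootSeq diskSeries = fun k : ℕ =>
    (Metric.closedBall (0 : ℂ) (1 / ((k : ℝ) + 1))).indicator fun _ => (1 : ℝ) := by
  funext k
  refine rootSeq_eq (indicator_one_nonneg _) ?_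
  rw [modulus_diskSeries_succ]
  funext z
  by_cases hz : z ∈ Metric.closedBall (0 : ℂ) (1 / ((k : ℝ) + 1))
  · simp only [Pi.pow_apply, Set.indicator_of_mem hz, one_pow]
  · simp only [Pi.pow_apply, Set.indicator_of_notMem hz, zero_pow k.succ_ne_zero]

theorem antitone_rootSeq_diskSeries : Antitone (rootSeq diskSeries) := by
  rw [rootSeq_diskSeries]
  intro i j h z
  refine Set.indicator_le_indicator_of_subset (Metric.closedBall_subset_closedBall ?_)
    (fun _ => zero_le_one) z
  exact one_div_le_one_div_of_le (by positivity) (by exact_mod_cast Nat.succ_le_succ h)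

theorem orderBounded_rootSeq_diskSeries : OrderBounded (rootSeq diskSeries) :=
  ⟨⟨0, by rintro _ ⟨k, rfl⟩; exact rootSeq_nonneg diskSeries k⟩,
    ⟨_, by rintro _ ⟨k, rfl⟩; exact antitone_rootSeq_diskSeries k.zero_le⟩⟩

theorem orderLimsup_rootSeq_diskSeries :
    orderLimsup (rootSeq diskSeries) = ({0} : Set ℂ).indicator (fun _ => (1 : ℝ)) := by
  rw [orderLimsup_of_antitone antitone_rootSeq_diskSeries orderBounded_rootSeq_diskSeries]
  have hle := fun k => ciInf_le orderBounded_rootSeq_diskSeries.1 k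
  refine le_antisymm (fun z => ?_) (le_ciInf fun k => ?_)
  · by_cases hz : z = 0
    · subst hz
      refine (hle 0 0).trans ?_
      simp [rootSeq_diskSeries]
    · obtain ⟨k, hk⟩ := exists_nat_one_div_lt (norm_pos_iff.2 hz)
      refine (hle k z).trans ?_
      have hz' : z ∉ Metric.closedBall (0 : ℂ) (1 / ((k : ℝ) + 1)) := by simpa using hk
      rw [rootSeq_diskSeries]
      simp only [Set.indicator_of_notMem hz']
      exact indicator_one_nonneg _ z
  · rw [rootSeq_diskSeries]
    intro z
    refine Set.indicator_le_indicator_of_subset ?_ (fun _ => zero_le_one) z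
    simp only [Set.singleton_subset_iff]
    exact Metric.mem_closedBall_self (by positivity)

theorem singleton_indicator_le_one :
    (({0} : Set ℂ).indicator fun _ => (1 : ℝ)) ≤ (1 : ℂ → ℝ) :=
  fun z => Set.indicator_le_self' (fun _ _ => zero_le_one) z

theorem singleton_indicator_ne_zero :
    (({0} : Set ℂ).indicator fun _ => (1 : ℝ)) ≠ (0 : ℂ → ℝ) := fun h => by
  simpa using congrFun h 0

theorem not_muchLess_singleton_indicator :
    ¬ MuchLess (({0} : Set ℂ).indicator fun _ => (1 : ℝ)) (1 : ℂ → ℝ) := by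
  intro h
  refine singleton_indicator_ne_zero (h.2 _ ?_)
  rw [abs_of_nonneg (indicator_one_nonneg _)]
  funext z
  by_cases hz : z = 0 <;> simp [hz]

/-- Every term from index `1` on dominates the nonzero function `χ_{0}`. -/
theorem not_seriesConverges_diskSeries : ¬ SeriesConverges diskSeries := by
  intro h
  refine singleton_indicator_ne_zero (le_antisymm (h.nonpos_of_le_modulus fun n z => ?_)
    (indicator_one_nonneg _))
  rw [modulus_diskSeries_succ]
  refine Set.indicator_le_indicator_of_subset ?_ (fun _ => zero_le_one) z
  simp only [Set.singleton_subset_iff]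
  exact Metric.mem_closedBall_self (by positivity)

end Functions

end CVL

theorem theorem3p5 {R : Type*} [Ring R] [Algebra ℝ R] [ConditionallyCompleteLattice R]
    [IsOrderedAddMonoid R] [PosSMulMono ℝ R] [IsLaterallyComplete R] [IsFAlgebra R] :
    -- (i)
    (∀ a : ℕ → Complexification R,
      OrderBounded (rootSeq a) → MuchLess (orderLimsup (rootSeq a)) 1 →
        SeriesConvergesAbsolutely a) ∧
    -- (ii)
    (∀ a : ℕ → Complexification R, SeriesConverges a →
      OrderBounded (rootSeq a) ∧ orderLimsup (rootSeq a) ≤ 1) ∧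
    -- (iii), a convergent series in the space at hand
    (OrderBounded (rootSeq (inverseSquares R)) ∧
      orderLimsup (rootSeq (inverseSquares R)) = 1 ∧
      (Nontrivial R → ¬ MuchLess (orderLimsup (rootSeq (inverseSquares R))) 1) ∧
      SeriesConverges (inverseSquares R)) ∧
    -- (iii), a divergent series in the space at hand
    (Nontrivial R → ∃ a : ℕ → Complexification R,
      OrderBounded (rootSeq a) ∧ orderLimsup (rootSeq a) ≤ 1 ∧
      ¬ MuchLess (orderLimsup (rootSeq a)) 1 ∧ ¬ SeriesConverges a) ∧
    -- (iii), a divergent series in the universally complete space `ℂ^ℂ`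
    ((IsLaterallyComplete (ℂ → ℝ) ∧ IsFAlgebra (ℂ → ℝ)) ∧
      OrderBounded (rootSeq diskSeries) ∧
      orderLimsup (rootSeq diskSeries) = ({0} : Set ℂ).indicator (fun _ => (1 : ℝ)) ∧
      orderLimsup (rootSeq diskSeries) ≤ 1 ∧
      ¬ MuchLess (orderLimsup (rootSeq diskSeries)) 1 ∧
      ¬ SeriesConverges diskSeries) := by
  -- The commutative structure extends the given ring, so the statements proved for it apply
  -- verbatim.
  let _ : CommRing R := { (inferInstance : Ring R) with mul_comm := mul_comm_of_isFAlgebra }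
  refine ⟨fun a hb hL => seriesConvergesAbsolutely_of_orderLimsup_muchLess hb hL,
    fun a h => h.rootSeq_bounds,
    ⟨orderBounded_rootSeq_inverseSquares, orderLimsup_rootSeq_inverseSquares, ?_,
      seriesConverges_inverseSquares⟩, ?_,
    ⟨inferInstance, inferInstance⟩, orderBounded_rootSeq_diskSeries,
    orderLimsup_rootSeq_diskSeries, ?_, ?_, not_seriesConverges_diskSeries⟩
  · intro _
    rw [orderLimsup_rootSeq_inverseSquares]
    exact not_muchLess_self 1
  · intro _
    have hL : orderLimsup (rootSeq fun _ => Complexification.ofReal (1 : R)) = 1 := by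
      rw [rootSeq_one, orderLimsup_const]
    refine ⟨fun _ => Complexification.ofReal 1, ?_, hL.le, ?_, not_seriesConverges_one⟩
    · rw [rootSeq_one]
      exact ⟨⟨1, by rintro _ ⟨_, rfl⟩; exact le_rfl⟩, ⟨1, by rintro _ ⟨_, rfl⟩; exact le_rfl⟩⟩
    · rw [hL]
      exact not_muchLess_self 1
  · rw [orderLimsup_rootSeq_diskSeries]
    exact singleton_indicator_le_one
  · rw [orderLimsup_rootSeq_diskSeries]
    exact not_muchLess_singleton_indicator
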